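/- Let $L\in\mathbb R^{m\times m}$ be symmetric positive definite, $\langle u,v\rangle=v^Tu$, and let $G:\mathbb R^m\to[0,\infty)^m$ and $g:\mathbb R^m\to\mathbb R^m$ satisfy $g=-\nabla\langle G(\cdot),1\rangle$, with $g$ Lipschitz continuous with constant $\ell_g>0$ in the Euclidean norm. Put $E[v]=\frac12\langle v,Lv\rangle+\langle G(v),1\rangle$ and, for a stabilization parameter $\kappa\ge 2\ell_g$, $L_\kappa=L+\kappa I$ and $g_\kappa(u)=g(u)+\kappa u$. Let $\varphi_0(z)=e^z$, $\varphi_j(z)=\int_0^1e^{(1-s)z}\frac{s^{j-1}}{(j-1)!}\,ds$ for $j\ge1$. The method EERK3-2 with abscissas $c_2,c_3$ has the coefficients, with $\gamma=\frac{(3c_3-2)c_3}{(2-3c_2)c_2}$, $$a_{21}(z)=c_2\varphi_1(c_2z),\quad a_{32}(z)=\gamma c_2\varphi_2(c_2z)+\tfrac{c_3^2}{c_2}\varphi_2(c_3z),\quad a_{31}(z)=c_3\varphi_1(c_3z)-a_{32}(z),$$ $$a_{42}(z)=\tfrac{\gamma}{\gamma c_2+c_3}\varphi_2(z),\quad a_{43}(z)=\tfrac{1}{\gamma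 c_2+c_3}\varphi_2(z),\quad a_{41}(z)=\varphi_1(z)-a_{42}(z)-a_{43}(z).$$ With step sizes $\tau=\tau_n>0$ (arbitrary, possibly variable), it computes $u^n$ from $u^{n-1}$ for $n\ge1$ by $U^{n,1}=u^{n-1}$, $$U^{n,i+1}=U^{n,1}+\sum_{j=1}^{i}a_{i+1,j}(-\tau L_\kappa)\bigl[\tau g_\kappa(U^{n,j})-\tau L_\kappa U^{n,1}\bigr]\quad(1\le i\le3),\qquad u^n=U^{n,4}.$$ Define the difference coefficients $\underline a_{i+1,i}=a_{i+1,i}$ and $\underline a_{i+1,j}=a_{i+1,j}-a_{i,j}$ for $j<i$, the kernels $\underline\theta_{k,k}=1/\underline a_{k+1,k}$ and $\underline\theta_{k,j}=-\sum_{\ell=j+1}^{k}\underline\theta_{k,\ell}\,\underline a_{\ell+1,j}/\underline a_{j+1,j}$ for $j<k$, and the lower triangular differentiation matrix $D(z)=(d_{k\ell}(z))_{3\times3}$ by $d_{k\ell}(z)=\underline\theta_{k\ell}(z)+\frac z2(2-\delta_{k\ell})$ for $\ell\le k$ and $d_{k\ell}=0$ for $\ell>k$. Write $\delta_\tau U^{n,k+1}=U^{n,k+1}-U^{n,k}$.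 Take $c_2=\frac12$ and $c_3=\frac7{10}$. Then the symmetric part $\frac12(D(z)+D(z)^T)$ is positive definite for every $z<0$, and the method preserves the energy dissipation law at all stages without any time-step restriction: for all $n\ge1$ and $1\le j\le3$, $$E[U^{n,j+1}]-E[U^{n,1}]\le-\frac1\tau\sum_{k=1}^{j}\Bigl\langle\delta_\tau U^{n,k+1},\sum_{\ell=1}^{k}d_{k\ell}(-\tau L_\kappa)\,\delta_\tau U^{n,\ell+1}\Bigr\rangle,$$ where the sum over $k$ on the right is nonnegative; in particular $E[U^{n,j+1}]\le E[U^{n,1}]$. -/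

import Mathlib

noncomputable section

namespace EERK

/-- The entire functions `φ₀(z) = e^z`, `φ_j(z) = ∫₀¹ e^{(1-s)z} s^{j-1}/(j-1)! ds` for `j ≥ 1`,
on the real line. -/
def phi (j : ℕ) (z : ℝ) : ℝ :=
  match j with
  | 0 => Real.exp z
  | m + 1 => ∫ s in (0 : ℝ)..1, Real.exp ((1 - s) * z) * (s ^ m / (Nat.factorial m : ℝ))

/-! Coefficient functions are indexed from 1: `a i j z` stands for `a_{i,j}(z)` with
`1 ≤ j < i ≤ s + 1`, and the weights are the last row, `b_j = a_{s+1,j}`. -/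

/-- `diffCoeff a i j` is the difference coefficient of index `(i+1, j)`: it is `a_{i+1,i}` for
`j = i` and `a_{i+1,j} - a_{i,j}` for `j ≤ i - 1`. -/
def diffCoeff (a : ℕ → ℕ → ℝ → ℝ) (i j : ℕ) (z : ℝ) : ℝ :=
  if j = i then a (i + 1) i z else a (i + 1) j z - a i j z

/-- The discrete orthogonal convolution (DOC) kernels `θ_{k,j}(z)`, by downward recursion on `j`;
they vanish for `j > k`. -/
def docKernel (a : ℕ → ℕ → ℝ → ℝ) (z : ℝ) (k j : ℕ) : ℝ :=
  if j < k then
    -∑ l : {l // l ∈ Finset.Icc (j + 1) k},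
      docKernel a z k l.1 * (diffCoeff a l.1 j z / diffCoeff a j j z)
  else if j = k then 1 / diffCoeff a k k z
  else 0
termination_by k - j
decreasing_by
  have h := Finset.mem_Icc.mp l.2
  omega

/-- The entries `d_{k,l}(z)` of the differentiation matrix. -/
def diffEntry (a : ℕ → ℕ → ℝ → ℝ) (k l : ℕ) (z : ℝ) : ℝ :=
  if l ≤ k then docKernel a z k l + z / 2 * (2 - if k = l then 1 else 0) else 0

/-- The (lower triangular) differentiation matrix `D(z)` of an `s`-stage method. -/
def diffMatrix (a : ℕ → ℕ → ℝ → ℝ) (s : ℕ) (z : ℝ) : Matrix (Fin s) (Fin s) ℝ :=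
  Matrix.of fun k l => diffEntry a (k.1 + 1) (l.1 + 1) z

/-- The symmetric part of a square matrix. -/
def symmPart {s : ℕ} (D : Matrix (Fin s) (Fin s) ℝ) : Matrix (Fin s) (Fin s) ℝ :=
  (1 / 2 : ℝ) • (D + D.transpose)

/-- The parameter `γ` of the two-parameter EERK3-2 family. -/
def gammaParam (c₂ c₃ : ℝ) : ℝ := (3 * c₃ - 2) * c₃ / ((2 - 3 * c₂) * c₂)

/-- The Butcher tableau of the two-parameter, three-stage method EERK3-2. -/
def eerk32 (c₂ c₃ : ℝ) : ℕ → ℕ → ℝ → ℝ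
  | 2, 1, z => c₂ * phi 1 (c₂ * z)
  | 3, 1, z => c₃ * phi 1 (c₃ * z) -
      (gammaParam c₂ c₃ * c₂ * phi 2 (c₂ * z) + c₃ ^ 2 / c₂ * phi 2 (c₃ * z))
  | 3, 2, z => gammaParam c₂ c₃ * c₂ * phi 2 (c₂ * z) + c₃ ^ 2 / c₂ * phi 2 (c₃ * z)
  | 4, 1, z => phi 1 z - gammaParam c₂ c₃ / (gammaParam c₂ c₃ * c₂ + c₃) * phi 2 z -
      1 / (gammaParam c₂ c₃ * c₂ + c₃) * phi 2 z
  | 4, 2, z => gammaParam c₂ c₃ / (gammaParam c₂ c₃ * c₂ + c₃) * phi 2 z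
  | 4, 3, z => 1 / (gammaParam c₂ c₃ * c₂ + c₃) * phi 2 z
  | _, _, _ => 0

variable {ι : Type*} [Fintype ι] [DecidableEq ι]

/-- Action of a real square matrix on `ℝ^ι` with the inner product `⟨u, v⟩ = vᵀ u`. -/
def act (M : Matrix ι ι ℝ) (v : EuclideanSpace ℝ ι) : EuclideanSpace ℝ ι :=
  Matrix.toEuclideanLin M v

/-- The energy `E[v] = ½ ⟨v, L v⟩ + ⟨G(v), 1⟩`. -/
def energy (L : Matrix ι ι ℝ) (G : EuclideanSpace ℝ ι → ι → ℝ) (v : EuclideanSpace ℝ ι) : ℝ :=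
  1 / 2 * inner ℝ v (act L v) + ∑ i, G v i

/-- The stabilized operator `L_κ = L + κ I`. -/
def stabL (L : Matrix ι ι ℝ) (κ : ℝ) : Matrix ι ι ℝ := L + κ • (1 : Matrix ι ι ℝ)

/-- The stabilized nonlinearity `g_κ(u) = g(u) + κ u`. -/
def stabG (g : EuclideanSpace ℝ ι → EuclideanSpace ℝ ι) (κ : ℝ) (u : EuclideanSpace ℝ ι) :
    EuclideanSpace ℝ ι := g u + κ • u

/-- The matrix function `f(-τ L_κ)` applied to a vector; `cfc` is the functional calculus of
symmetric matrices (`f` acts on the eigenvalues). -/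
def matFun (L : Matrix ι ι ℝ) (κ τ : ℝ) (f : ℝ → ℝ) (v : EuclideanSpace ℝ ι) :
    EuclideanSpace ℝ ι :=
  act (cfc f (-(τ • stabL L κ))) v

/-- `U 1, …, U (s+1)` are the stages of one step, of size `τ`, of the `s`-stage EERK method with
coefficients `a`, applied to the stabilized problem `u' = -L_κ u + g_κ(u)`:
`U_{i+1} = U_1 + ∑_{j=1}^{i} a_{i+1,j}(-τ L_κ) (τ g_κ(U_j) - τ L_κ U_1)` for `1 ≤ i ≤ s`. -/
def IsStep (a : ℕ → ℕ → ℝ → ℝ) (s : ℕ) (L : Matrix ι ι ℝ)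
    (g : EuclideanSpace ℝ ι → EuclideanSpace ℝ ι) (κ τ : ℝ) (U : ℕ → EuclideanSpace ℝ ι) : Prop :=
  ∀ i ∈ Finset.Icc 1 s, U (i + 1) = U 1 + ∑ j ∈ Finset.Icc 1 i,
    matFun L κ τ (a (i + 1) j) (τ • stabG g κ (U j) - τ • act (stabL L κ) (U 1))

/-- `u` is the numerical solution, with step sizes `τ n` and stages `U n i`:
`U^{n,1} = u^{n-1}` and `u^n = U^{n,s+1}`. -/
def IsSolution (a : ℕ → ℕ → ℝ → ℝ) (s : ℕ) (L : Matrix ι ι ℝ)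
    (g : EuclideanSpace ℝ ι → EuclideanSpace ℝ ι) (κ : ℝ) (τ : ℕ → ℝ)
    (u : ℕ → EuclideanSpace ℝ ι) (U : ℕ → ℕ → EuclideanSpace ℝ ι) : Prop :=
  ∀ n, 1 ≤ n → U n 1 = u (n - 1) ∧ IsStep a s L g κ (τ n) (U n) ∧ u n = U n (s + 1)

/-- The quadratic form
`∑_{k=1}^{j} ⟨δU_{k+1}, ∑_{l=1}^{k} d_{k,l}(-τ L_κ) δU_{l+1}⟩` with `δU_{i+1} = U_{i+1} - U_i`. -/
def dissipation (a : ℕ → ℕ → ℝ → ℝ) (L : Matrix ι ι ℝ) (κ τ : ℝ)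
    (U : ℕ → EuclideanSpace ℝ ι) (j : ℕ) : ℝ :=
  ∑ k ∈ Finset.Icc 1 j, inner ℝ (U (k + 1) - U k)
    (∑ l ∈ Finset.Icc 1 k, matFun L κ τ (diffEntry a k l) (U (l + 1) - U l))

end EERK

end

noncomputable section

namespace EERK

/-- The exponential polynomial `∑ v t^i e^{k t}`, the sum over the triples `(v, i, k)` in `l`. -/
def expSum (l : List (ℤ × ℕ × ℕ)) (t : ℝ) : ℝ :=
  (l.map fun c => (c.1 : ℝ) * (t ^ c.2.1 * Real.exp (c.2.2 * t))).sum

/-- The `n`-th derivative at `0` of `expSum l`. -/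
def expCoeff (l : List (ℤ × ℕ × ℕ)) (n : ℕ) : ℤ :=
  (l.map fun c => c.1 * ((n.descFactorial c.2.1 * c.2.2 ^ (n - c.2.1) : ℕ) : ℤ)).sum

theorem hasSum_pow_mul_exp (i k : ℕ) (t : ℝ) :
    HasSum (fun n : ℕ => ((n.descFactorial i * k ^ (n - i) : ℕ) : ℝ) * (t ^ n / n.factorial))
      (t ^ i * Real.exp (k * t)) := by
  rw [← hasSum_nat_add_iff' i, Finset.sum_eq_zero, sub_zero]
  · have h := (NormedSpace.expSeries_div_hasSum_exp ((k : ℝ) * t)).mul_left (t ^ i)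
    rw [← Real.exp_eq_exp_ℝ] at h
    refine h.congr_fun fun n => ?_
    have h1 := Nat.factorial_mul_descFactorial (Nat.le_add_left i n)
    rw [Nat.add_sub_cancel] at h1 ⊢
    have h2 : ((n.factorial : ℝ)) ≠ 0 := by positivity
    have h3 : (((n + i).factorial : ℝ)) ≠ 0 := by positivity
    have h4 : (n.factorial : ℝ) * ((n + i).descFactorial i : ℝ) = (n + i).factorial := by
      exact_mod_cast h1
    push_cast
    rw [← h4] at h3 ⊢
    have h5 := right_ne_zero_of_mul h3
    field_simp
    ring
  · intro n hn
    rw [Nat.descFactorial_of_lt (Finset.mem_range.mp hn)]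
    simp

theorem hasSum_expSum (l : List (ℤ × ℕ × ℕ)) (t : ℝ) :
    HasSum (fun n : ℕ => (expCoeff l n : ℝ) * (t ^ n / n.factorial)) (expSum l t) := by
  induction l with
  | nil => simp [expCoeff, expSum, hasSum_zero]
  | cons c l ih =>
    have h := ((hasSum_pow_mul_exp c.2.1 c.2.2 t).mul_left (c.1 : ℝ)).add ih
    simp only [expCoeff, expSum, List.map_cons, List.sum_cons] at h ⊢
    refine h.congr_fun fun n => ?_
    push_cast
    ring

theorem expSum_pos {l : List (ℤ × ℕ × ℕ)} (h : ∀ n, 0 ≤ expCoeff l n) {m : ℕ}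
    (hm : 0 < expCoeff l m) {t : ℝ} (ht : 0 < t) : 0 < expSum l t := by
  have hs := hasSum_expSum l t
  rw [← hs.tsum_eq]
  refine hs.summable.tsum_pos (fun n => ?_) m ?_
  · have := h n
    positivity
  · positivity

theorem expCoeff_append (l l' : List (ℤ × ℕ × ℕ)) (n : ℕ) :
    expCoeff (l ++ l') n = expCoeff l n + expCoeff l' n := by
  simp [expCoeff]

theorem abs_expCoeff_le {l : List (ℤ × ℕ × ℕ)} {d K : ℕ} (h : ∀ c ∈ l, c.2.1 ≤ d ∧ c.2.2 ≤ K)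
    {n : ℕ} (hn : d ≤ n) (hn' : 1 ≤ n) :
    |expCoeff l n| ≤
      (l.map fun c => |c.1| * (K : ℤ) ^ (d - c.2.1)).sum * ((n : ℤ) ^ d * (K : ℤ) ^ (n - d)) := by
  induction l with
  | nil => simp [expCoeff]
  | cons c l ih =>
    have ih := ih fun c hc => h c (List.mem_cons_of_mem _ hc)
    obtain ⟨h1, h2⟩ := h c List.mem_cons_self
    simp only [expCoeff, List.map_cons, List.sum_cons] at ih ⊢
    refine (abs_add_le _ _).trans ?_
    rw [add_mul]
    refine add_le_add ?_ ih
    rw [abs_mul, mul_assoc, Nat.abs_cast]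
    refine mul_le_mul_of_nonneg_left ?_ (abs_nonneg _)
    have h3 : n.descFactorial c.2.1 * c.2.2 ^ (n - c.2.1) ≤ n ^ d * K ^ (n - c.2.1) :=
      Nat.mul_le_mul ((Nat.descFactorial_le_pow _ _).trans (Nat.pow_le_pow_right hn' h1))
        (Nat.pow_le_pow_left h2 _)
    have h4 : n ^ d * K ^ (n - c.2.1) = K ^ (d - c.2.1) * (n ^ d * K ^ (n - d)) := by
      rw [show n - c.2.1 = (d - c.2.1) + (n - d) by omega, pow_add]
      ring
    rw [h4] at h3
    exact_mod_cast h3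

/-- The terms with the largest exponent in the exponential polynomials of EERK3-2. -/
def leadTerms : List (ℤ × ℕ × ℕ) :=
  [(256000, 0, 40), (-4806561, 1, 40), (20079660, 2, 40), (2515100, 3, 40)]

theorem le_expCoeff_leadTerms {n : ℕ} (hn : 100 ≤ n) :
    2515100 * ((n : ℤ) ^ 3 * 40 ^ (n - 3)) ≤ expCoeff leadTerms n := by
  obtain ⟨m, rfl⟩ := Nat.exists_eq_add_of_le' (show 3 ≤ n by omega)
  have hm : (97 : ℤ) ≤ m := by
    have : 97 ≤ m := by omega
    exact_mod_cast this
  simp only [expCoeff, leadTerms, List.map_cons, List.map_nil, List.sum_cons, List.sum_nil,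
    Nat.descFactorial_succ, Nat.descFactorial_zero]
  rw [show m + 3 - 0 = m + 3 by omega, show m + 3 - 1 = m + 2 by omega,
    show m + 3 - 2 = m + 1 by omega, show m + 3 - 3 = m by omega]
  have h : (0 : ℤ) < 40 ^ m := pow_pos (by norm_num) m
  push_cast
  simp only [pow_succ (40 : ℤ) m, pow_succ (40 : ℤ) (m + 1), pow_succ (40 : ℤ) (m + 2)]
  generalize (40 : ℤ) ^ m = w at *
  generalize (m : ℤ) = m at *
  have h2 : 0 ≤ w * ((m + 3) * (795641100 * (m + 3) - 8488653800) + 16384000000) := by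
    refine mul_nonneg h.le (add_nonneg (mul_nonneg ?_ ?_) ?_) <;> linarith
  linarith

theorem expCoeff_leadTerms_append_nonneg {l : List (ℤ × ℕ × ℕ)}
    (h : ∀ c ∈ l, c.2.1 ≤ 3 ∧ c.2.2 ≤ 35)
    (hC : (l.map fun c => |c.1| * ((35 : ℕ) : ℤ) ^ (3 - c.2.1)).sum ≤ 112553730975)
    (h0 : ∀ n < 100, 0 ≤ expCoeff (leadTerms ++ l) n) (n : ℕ) :
    0 ≤ expCoeff (leadTerms ++ l) n := by
  rcases lt_or_ge n 100 with hn | hn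
  · exact h0 n hn
  rw [expCoeff_append]
  have h1 := le_expCoeff_leadTerms hn
  have h2 := neg_le_of_abs_le (abs_expCoeff_le h (n := n) (by omega) (by omega))
  have h3 : (112553730975 : ℤ) * 35 ^ (n - 3) ≤ 2515100 * 40 ^ (n - 3) := by
    obtain ⟨m, rfl⟩ := Nat.exists_eq_add_of_le' hn
    rw [show m + 100 - 3 = m + 97 by omega, pow_add, pow_add]
    have h4 : (35 : ℤ) ^ m ≤ 40 ^ m := pow_le_pow_left₀ (by norm_num) (by norm_num) m
    calc (112553730975 : ℤ) * (35 ^ m * 35 ^ 97) = (112553730975 * 35 ^ 97) * 35 ^ m := by ring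
      _ ≤ (2515100 * 40 ^ 97) * 40 ^ m :=
        mul_le_mul (by norm_num) h4 (by positivity) (by positivity)
      _ = _ := by ring
  have h5 : (0 : ℤ) ≤ (n : ℤ) ^ 3 := by positivity
  have h6 := mul_le_mul_of_nonneg_left h3 h5
  have h7 := mul_le_mul_of_nonneg_right hC
    (show (0 : ℤ) ≤ (n : ℤ) ^ 3 * ((35 : ℕ) : ℤ) ^ (n - 3) by positivity)
  push_cast at h2 h7
  linarith

/-- The DOC kernels are the inverse of the difference coefficients. -/
theorem sum_docKernel_mul_diffCoeff {a : ℕ → ℕ → ℝ → ℝ} {z : ℝ} {j k : ℕ} (hjk : j ≤ k)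
    (hj : diffCoeff a j j z ≠ 0) :
    ∑ l ∈ Finset.Icc j k, docKernel a z k l * diffCoeff a l j z = if j = k then 1 else 0 := by
  rcases hjk.lt_or_eq with h | rfl
  · rw [← Finset.add_sum_Ioc_eq_sum_Icc hjk, docKernel, if_pos h, if_neg h.ne,
      Finset.sum_coe_sort (Finset.Icc (j + 1) k)
        (fun l => docKernel a z k l * (diffCoeff a l j z / diffCoeff a j j z)),
      neg_mul, Finset.sum_mul]
    have : Finset.Icc (j + 1) k = Finset.Ioc j k := by
      ext; simp
    rw [this, neg_add_eq_zero]
    refine Finset.sum_congr rfl fun l _ => ?_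
    field_simp
  · rw [Finset.Icc_self, Finset.sum_singleton, docKernel, if_neg (lt_irrefl _), if_pos rfl,
      if_pos rfl, one_div_mul_cancel hj]

theorem sum_docKernel_mul {a : ℕ → ℕ → ℝ → ℝ} {z : ℝ} {k : ℕ} (hk : 1 ≤ k) {v V : ℕ → ℝ}
    (ha : ∀ j ∈ Finset.Icc 1 k, diffCoeff a j j z ≠ 0)
    (hv : ∀ l ∈ Finset.Icc 1 k, v l = ∑ j ∈ Finset.Icc 1 l, diffCoeff a l j z * V j) :
    ∑ l ∈ Finset.Icc 1 k, docKernel a z k l * v l = V k := by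
  calc ∑ l ∈ Finset.Icc 1 k, docKernel a z k l * v l
      = ∑ l ∈ Finset.Icc 1 k, ∑ j ∈ Finset.Icc 1 l,
          docKernel a z k l * diffCoeff a l j z * V j := by
        refine Finset.sum_congr rfl fun l hl => ?_
        rw [hv l hl, Finset.mul_sum]
        simp only [mul_assoc]
    _ = ∑ j ∈ Finset.Icc 1 k, ∑ l ∈ Finset.Icc j k,
          docKernel a z k l * diffCoeff a l j z * V j := by
        refine Finset.sum_comm' fun l j => ?_
        simp only [Finset.mem_Icc]
        omega
    _ = ∑ j ∈ Finset.Icc 1 k, (if j = k then 1 else 0) * V j := by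
        refine Finset.sum_congr rfl fun j hj => ?_
        rw [← Finset.sum_mul, sum_docKernel_mul_diffCoeff (Finset.mem_Icc.mp hj).2 (ha j hj)]
    _ = V k := by simp [hk]

theorem sum_diffEntry_mul {a : ℕ → ℕ → ℝ → ℝ} {z : ℝ} {k : ℕ} (hk : 1 ≤ k) {v V : ℕ → ℝ}
    (ha : ∀ j ∈ Finset.Icc 1 k, diffCoeff a j j z ≠ 0)
    (hv : ∀ l ∈ Finset.Icc 1 k, v l = ∑ j ∈ Finset.Icc 1 l, diffCoeff a l j z * V j) :
    ∑ l ∈ Finset.Icc 1 k, diffEntry a k l z * v l =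
      V k + z * ∑ l ∈ Finset.Icc 1 k, v l - z / 2 * v k := by
  have h : ∀ l ∈ Finset.Icc 1 k, diffEntry a k l z * v l =
      docKernel a z k l * v l + (z * v l - z / 2 * if k = l then v l else 0) := by
    intro l hl
    rw [diffEntry, if_pos (Finset.mem_Icc.mp hl).2]
    split_ifs <;> ring
  rw [Finset.sum_congr rfl h, Finset.sum_add_distrib, sum_docKernel_mul hk ha hv,
    Finset.sum_sub_distrib, ← Finset.mul_sum, ← Finset.mul_sum, Finset.sum_ite_eq,
    if_pos (Finset.mem_Icc.mpr ⟨hk, le_rfl⟩)]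
  ring

/-- The quadratic form `∑_{k ≤ j} v_k ∑_{l ≤ k} d_{k,l}(z) v_l`. -/
def diffForm (a : ℕ → ℕ → ℝ → ℝ) (j : ℕ) (z : ℝ) (v : ℕ → ℝ) : ℝ :=
  ∑ k ∈ Finset.Icc 1 j, v k * ∑ l ∈ Finset.Icc 1 k, diffEntry a k l z * v l

theorem diffForm_eq_of_le (a : ℕ → ℕ → ℝ → ℝ) {j s : ℕ} (hj : j ≤ s) (z : ℝ) (v : ℕ → ℝ) :
    diffForm a j z v = diffForm a s z fun k => if k ≤ j then v k else 0 := by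
  have hsub : Finset.Icc 1 j ⊆ Finset.Icc 1 s := Finset.Icc_subset_Icc_right hj
  unfold diffForm
  rw [← Finset.sum_subset hsub]
  · refine Finset.sum_congr rfl fun k hk => ?_
    have hk := (Finset.mem_Icc.mp hk).2
    simp only [if_pos hk]
    congr 1
    refine Finset.sum_congr rfl fun l hl => ?_
    rw [if_pos ((Finset.mem_Icc.mp hl).2.trans hk)]
  · intro k hk hk'
    have hkj : ¬k ≤ j := fun h => hk' (Finset.mem_Icc.mpr ⟨(Finset.mem_Icc.mp hk).1, h⟩)
    simp only [if_neg hkj, zero_mul]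

theorem dotProduct_symmPart_mulVec {s : ℕ} (D : Matrix (Fin s) (Fin s) ℝ) (x : Fin s → ℝ) :
    x ⬝ᵥ (symmPart D).mulVec x = x ⬝ᵥ D.mulVec x := by
  rw [symmPart, Matrix.smul_mulVec, Matrix.add_mulVec, Matrix.mulVec_transpose, dotProduct_smul,
    dotProduct_add, dotProduct_comm x (Matrix.vecMul x D), ← Matrix.dotProduct_mulVec, smul_eq_mul]
  ring

theorem isHermitian_symmPart {s : ℕ} (D : Matrix (Fin s) (Fin s) ℝ) :
    (symmPart D).IsHermitian := by
  unfold symmPart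
  ext i j
  simp [add_comm, mul_add]

theorem dotProduct_diffMatrix_mulVec (a : ℕ → ℕ → ℝ → ℝ) (z : ℝ) (v : ℕ → ℝ) :
    (fun i : Fin 3 => v (i + 1)) ⬝ᵥ (diffMatrix a 3 z).mulVec (fun i : Fin 3 => v (i + 1)) =
      diffForm a 3 z v := by
  have h12 : diffEntry a 1 2 z = 0 := by simp [diffEntry]
  have h13 : diffEntry a 1 3 z = 0 := by simp [diffEntry]
  have h23 : diffEntry a 2 3 z = 0 := by simp [diffEntry]
  simp [diffForm, diffMatrix, Matrix.mulVec, dotProduct, Fin.sum_univ_three,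
    Finset.sum_Icc_succ_top, h12, h13, h23]

theorem posDef_symmPart_diffMatrix {a : ℕ → ℕ → ℝ → ℝ} {z : ℝ}
    (h : ∀ v : ℕ → ℝ, (v 1 ≠ 0 ∨ v 2 ≠ 0 ∨ v 3 ≠ 0) → 0 < diffForm a 3 z v) :
    (symmPart (diffMatrix a 3 z)).PosDef := by
  refine Matrix.PosDef.of_dotProduct_mulVec_pos (isHermitian_symmPart _) fun x hx => ?_
  rw [star_trivial, dotProduct_symmPart_mulVec]
  have key := dotProduct_diffMatrix_mulVec a z fun k => x (Fin.ofNat 3 (k - 1))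
  have hx' : (fun i : Fin 3 => x (Fin.ofNat 3 (i.1 + 1 - 1))) = x := by
    ext i
    congr 1
    ext
    simp
  simp only [hx'] at key
  rw [key]
  refine h _ ?_
  by_contra! hc
  apply hx
  ext i
  fin_cases i
  · exact hc.1
  · exact hc.2.1
  · exact hc.2.2

theorem diffForm_three_eq {a : ℕ → ℕ → ℝ → ℝ} {z : ℝ} {v V : ℕ → ℝ}
    (ha : ∀ j ∈ Finset.Icc 1 3, diffCoeff a j j z ≠ 0)
    (hv : ∀ l ∈ Finset.Icc 1 3, v l = ∑ j ∈ Finset.Icc 1 l, diffCoeff a l j z * V j) :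
    diffForm a 3 z v = v 1 * V 1 + v 2 * V 2 + v 3 * V 3 + z / 2 * (v 1 + v 2 + v 3) ^ 2 := by
  have h : ∀ k ∈ Finset.Icc 1 3, v k * ∑ l ∈ Finset.Icc 1 k, diffEntry a k l z * v l =
      v k * (V k + z * ∑ l ∈ Finset.Icc 1 k, v l - z / 2 * v k) := by
    intro k hk
    have hk' := Finset.mem_Icc.mp hk
    have hsub : Finset.Icc 1 k ⊆ Finset.Icc 1 3 := Finset.Icc_subset_Icc_right hk'.2
    rw [sum_diffEntry_mul hk'.1 (fun j hj => ha j (hsub hj)) fun j hj => hv j (hsub hj)]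
  rw [diffForm, Finset.sum_congr rfl h]
  simp only [Finset.sum_Icc_succ_top, Nat.reduceAdd, Finset.Icc_self,
    Finset.sum_singleton, Nat.one_le_ofNat]
  ring

theorem ternary_quadForm_pos {A B C D E F : ℝ} (hF : 0 < F) (hm : 0 < C * F - E ^ 2)
    (hd : 0 < A * (C * F - E ^ 2) - B * (B * F - E * D) + D * (B * E - C * D)) {x y w : ℝ}
    (h : x ≠ 0 ∨ y ≠ 0 ∨ w ≠ 0) :
    0 < A * x ^ 2 + C * y ^ 2 + F * w ^ 2 + 2 * B * x * y + 2 * D * x * w + 2 * E * y * w := by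
  set m := C * F - E ^ 2 with hm'
  set d := A * m - B * (B * F - E * D) + D * (B * E - C * D) with hd'
  have key : F * m * (A * x ^ 2 + C * y ^ 2 + F * w ^ 2 + 2 * B * x * y + 2 * D * x * w +
      2 * E * y * w) =
      m * (D * x + E * y + F * w) ^ 2 + (m * y + (B * F - D * E) * x) ^ 2 + F * d * x ^ 2 := by
    rw [hd', hm']
    ring
  refine pos_of_mul_pos_right (b := _) (a := F * m) ?_ (by positivity)
  rw [key]
  by_cases hx : x = 0
  · by_cases hy : y = 0
    · have hw : w ≠ 0 := by tauto
      subst hx hy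
      have : m * (D * 0 + E * 0 + F * w) ^ 2 = m * (F ^ 2 * w ^ 2) := by ring
      rw [this]
      positivity
    · have : 0 < (m * y + (B * F - D * E) * x) ^ 2 := by
        rw [hx, mul_zero, add_zero]
        positivity
      positivity
  · positivity

theorem phi_one {z : ℝ} (hz : z ≠ 0) : phi 1 z = (Real.exp z - 1) / z := by
  have hderiv : ∀ s ∈ Set.uIcc (0 : ℝ) 1, HasDerivAt (fun s => -(Real.exp ((1 - s) * z) / z))
      (Real.exp ((1 - s) * z) * (s ^ 0 / (Nat.factorial 0 : ℝ))) s := by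
    intro s _
    have h := ((((hasDerivAt_id s).const_sub 1).mul_const z).exp.div_const z).neg
    refine h.congr_deriv ?_
    simp only [id, pow_zero, Nat.factorial_zero, Nat.cast_one]
    field_simp
  rw [phi, intervalIntegral.integral_eq_sub_of_hasDerivAt hderiv
    (Continuous.intervalIntegrable (by fun_prop) _ _)]
  simp
  ring

theorem phi_two {z : ℝ} (hz : z ≠ 0) : phi 2 z = (Real.exp z - 1 - z) / z ^ 2 := by
  have hderiv : ∀ s ∈ Set.uIcc (0 : ℝ) 1,
      HasDerivAt (fun s => Real.exp ((1 - s) * z) * (-(s * z + 1) / z ^ 2))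
      (Real.exp ((1 - s) * z) * (s ^ 1 / (Nat.factorial 1 : ℝ))) s := by
    intro s _
    have h := (((hasDerivAt_id s).const_sub 1).mul_const z).exp.mul
      ((((hasDerivAt_id s).mul_const z).add_const 1).neg.div_const (z ^ 2))
    refine h.congr_deriv ?_
    simp only [id, pow_one, Nat.factorial_one, Nat.cast_one, Pi.neg_apply]
    field_simp
    ring
  rw [phi, intervalIntegral.integral_eq_sub_of_hasDerivAt hderiv
    (Continuous.intervalIntegrable (by fun_prop) _ _)]
  simp
  field_simp
  ring

theorem expSum_eq_exp_mul {l : List (ℤ × ℕ × ℕ)} {M : ℕ} (h : ∀ c ∈ l, c.2.2 ≤ M) (t : ℝ) :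
    expSum l t = Real.exp (M * t) *
      (l.map fun c => (c.1 : ℝ) * (t ^ c.2.1 * Real.exp (-t) ^ (M - c.2.2))).sum := by
  induction l with
  | nil => simp [expSum]
  | cons c l ih =>
    have ih := ih fun c hc => h c (List.mem_cons_of_mem _ hc)
    have hc := h c List.mem_cons_self
    simp only [expSum, List.map_cons, List.sum_cons] at ih ⊢
    rw [ih, mul_add, ← Real.exp_nat_mul, Nat.cast_sub hc,
      show (c.2.2 : ℝ) * t = M * t + ((M : ℝ) - c.2.2) * -t by ring, Real.exp_add]
    ring

/-- The lower order terms of the trailing principal minor of order two for EERK3-2. -/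
def minorTerms : List (ℤ × ℕ × ℕ) :=
  [(-56000, 0, 35), (1072372, 1, 35), (-2407160, 2, 35), (-200000, 0, 33), (3829900, 1, 33),
   (-8597000, 2, 33), (-512000, 0, 30), (4624414, 1, 30), (-9075500, 2, 30), (-617400, 1, 28),
   (-1102500, 1, 26), (112000, 0, 25), (-282100, 1, 25), (400000, 0, 23), (-1007500, 1, 23),
   (256000, 0, 20), (-1710625, 1, 20), (-56000, 0, 15), (-200000, 0, 13)]

/-- The lower order terms of the determinant for EERK3-2. -/
def detTerms : List (ℤ × ℕ × ℕ) :=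
  [(-56000, 0, 35), (1072372, 1, 35), (-2407160, 2, 35), (-200000, 0, 33), (3829900, 1, 33),
   (-8597000, 2, 33), (-512000, 0, 30), (5015039, 1, 30), (-10325500, 2, 30), (-26562500, 3, 30),
   (-1617400, 1, 28), (19149500, 2, 28), (-42985000, 3, 28), (-462500, 1, 26), (-4400000, 2, 26),
   (-20000000, 3, 26), (112000, 0, 25), (-1962100, 1, 25), (15550500, 2, 25), (-36015000, 3, 25),
   (400000, 0, 23), (-3157900, 1, 23), (16579500, 2, 23), (-30135000, 3, 23), (-11025000, 2, 21),
   (256000, 0, 20), (-318039, 1, 20), (-8934160, 2, 20), (-14817600, 3, 20), (3782900, 1, 18),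
   (-8754500, 2, 18), (400000, 1, 16), (-1375000, 2, 16), (-56000, 0, 15), (889728, 1, 15),
   (-10763340, 2, 15), (-200000, 0, 13), (-672000, 1, 13), (-4777500, 2, 13), (109561, 1, 10),
   (-2165500, 1, 8), (62500, 1, 6)]

theorem expSum_minorTerms_pos {t : ℝ} (ht : 0 < t) : 0 < expSum (leadTerms ++ minorTerms) t :=
  expSum_pos (expCoeff_leadTerms_append_nonneg (by decide +kernel) (by decide +kernel)
    (by decide +kernel)) (m := 5) (by decide +kernel) ht

theorem expSum_detTerms_pos {t : ℝ} (ht : 0 < t) : 0 < expSum (leadTerms ++ detTerms) t :=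
  expSum_pos (expCoeff_leadTerms_append_nonneg (by decide +kernel) (by decide +kernel)
    (by decide +kernel)) (m := 6) (by decide +kernel) ht

theorem eerk32_minor_pos {t x Q R : ℝ} (ht : 0 < t) (hx : x = 10 * t)
    (hQ : Q = 42 / 25 * x - 64 / 25 + 14 / 25 * Real.exp (-t) ^ 5 + 2 * Real.exp (-t) ^ 7)
    (hR : R = 25 / 21 * (x - 1 + Real.exp (-t) ^ 10)) :
    0 < (x * Q - (7 / 25 * R) ^ 2 / 2) * (x * R - R ^ 2 / 2) -
      (x * (7 / 25 * R - Q) / 2 - 7 / 25 * R ^ 2 / 2) ^ 2 := by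
  have h := expSum_minorTerms_pos ht
  rw [expSum_eq_exp_mul (M := 40) (by decide)] at h
  have h := pos_of_mul_pos_right h (Real.exp_pos _).le
  simp only [leadTerms, minorTerms, List.cons_append, List.nil_append, List.map_cons,
    List.map_nil, List.sum_cons, List.sum_nil, Nat.reduceSub] at h
  generalize Real.exp (-t) = y at *
  subst hx hQ hR
  refine lt_of_lt_of_eq (mul_pos (show 0 < 10 * t * (1 / 110250) by positivity) h) ?_
  push_cast
  ring

theorem eerk32_det_pos {t x A Q R X W S₁₁ S₂₁ S₂₂ S₃₁ S₃₂ S₃₃ : ℝ} (ht : 0 < t) (hx : x = 10 * t)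
    (hA : A = 1 - Real.exp (-t) ^ 5)
    (hQ : Q = 42 / 25 * x - 64 / 25 + 14 / 25 * Real.exp (-t) ^ 5 + 2 * Real.exp (-t) ^ 7)
    (hR : R = 25 / 21 * (x - 1 + Real.exp (-t) ^ 10))
    (hX : X = x * (1 - Real.exp (-t) ^ 7) - Q)
    (hW : W = x * (1 - Real.exp (-t) ^ 10) - 32 / 25 * R)
    (h₁₁ : S₁₁ = x ^ 2 * A - W ^ 2 / 2) (h₂₁ : S₂₁ = x * (X - x * A) / 2 - W * (7 / 25 * R) / 2)
    (h₂₂ : S₂₂ = x * Q - (7 / 25 * R) ^ 2 / 2) (h₃₁ : S₃₁ = x * (W - X) / 2 - W * R / 2)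
    (h₃₂ : S₃₂ = x * (7 / 25 * R - Q) / 2 - 7 / 25 * R ^ 2 / 2)
    (h₃₃ : S₃₃ = x * R - R ^ 2 / 2) :
    0 < S₁₁ * (S₂₂ * S₃₃ - S₃₂ ^ 2) - S₂₁ * (S₂₁ * S₃₃ - S₃₂ * S₃₁) +
      S₃₁ * (S₂₁ * S₃₂ - S₂₂ * S₃₁) := by
  have h := expSum_detTerms_pos ht
  rw [expSum_eq_exp_mul (M := 40) (by decide)] at h
  have h := pos_of_mul_pos_right h (Real.exp_pos _).le
  simp only [leadTerms, detTerms, List.cons_append, List.nil_append, List.map_cons,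
    List.map_nil, List.sum_cons, List.sum_nil, Nat.reduceSub] at h
  generalize Real.exp (-t) = y at *
  subst hx hQ hR hX hW hA h₁₁ h₂₁ h₂₂ h₃₁ h₃₂ h₃₃
  refine lt_of_lt_of_eq (mul_pos (show 0 < (10 * t) ^ 3 * (1 / 220500) by positivity) h) ?_
  push_cast
  ring

theorem gammaParam_eq : gammaParam (1 / 2) (7 / 10) = 7 / 25 := by
  norm_num [gammaParam]

/-- The coefficients of EERK3-2 with `c₂ = 1/2`, `c₃ = 7/10` at `z = -10 t`, in terms of `x = 10 t`
and `exp (-t)`. -/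
theorem eerk32_apply {t x A Q R X W : ℝ} (ht : 0 < t) (hx : x = 10 * t)
    (hA : A = 1 - Real.exp (-t) ^ 5)
    (hQ : Q = 42 / 25 * x - 64 / 25 + 14 / 25 * Real.exp (-t) ^ 5 + 2 * Real.exp (-t) ^ 7)
    (hR : R = 25 / 21 * (x - 1 + Real.exp (-t) ^ 10))
    (hX : X = x * (1 - Real.exp (-t) ^ 7) - Q)
    (hW : W = x * (1 - Real.exp (-t) ^ 10) - 32 / 25 * R) :
    eerk32 (1 / 2) (7 / 10) 2 1 (-x) = A / x ∧ eerk32 (1 / 2) (7 / 10) 3 1 (-x) = X / x ^ 2 ∧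
    eerk32 (1 / 2) (7 / 10) 3 2 (-x) = Q / x ^ 2 ∧ eerk32 (1 / 2) (7 / 10) 4 1 (-x) = W / x ^ 2 ∧
    eerk32 (1 / 2) (7 / 10) 4 2 (-x) = 7 / 25 * R / x ^ 2 ∧
    eerk32 (1 / 2) (7 / 10) 4 3 (-x) = R / x ^ 2 := by
  have h5 : Real.exp (1 / 2 * -x) = Real.exp (-t) ^ 5 := by
    rw [← Real.exp_nat_mul, hx]
    congr 1
    push_cast
    ring
  have h7 : Real.exp (7 / 10 * -x) = Real.exp (-t) ^ 7 := by
    rw [← Real.exp_nat_mul, hx]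
    congr 1
    push_cast
    ring
  have h10 : Real.exp (-x) = Real.exp (-t) ^ 10 := by
    rw [← Real.exp_nat_mul, hx]
    congr 1
    push_cast
    ring
  have hx0 : x ≠ 0 := by
    rw [hx]
    positivity
  have hx5 : 1 / 2 * -x ≠ 0 := by simpa using hx0
  have hx7 : 7 / 10 * -x ≠ 0 := by simpa using hx0
  have hx10 : -x ≠ 0 := by simpa using hx0
  simp only [eerk32, gammaParam_eq, phi_one hx5, phi_one hx7, phi_one hx10, phi_two hx5,
    phi_two hx7, phi_two hx10, h5, h7, h10]
  clear h5 h7 h10 hx5 hx7 hx10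
  generalize Real.exp (-t) = y at *
  clear hx ht
  subst hA hX hW hQ hR
  refine ⟨?_, ?_, ?_, ?_, ?_, ?_⟩ <;> field_simp <;> ring

theorem eerk32_coeff_pos {t x A Q R : ℝ} (ht : 0 < t) (hx : x = 10 * t)
    (hA : A = 1 - Real.exp (-t) ^ 5)
    (hQ : Q = 42 / 25 * x - 64 / 25 + 14 / 25 * Real.exp (-t) ^ 5 + 2 * Real.exp (-t) ^ 7)
    (hR : R = 25 / 21 * (x - 1 + Real.exp (-t) ^ 10)) :
    0 < A ∧ 0 < Q ∧ 0 < R ∧ R < 2 * x := by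
  have hlt : Real.exp (-t) < 1 := by simpa using ht
  have h0 := (Real.exp_pos (-t)).le
  have key : ∀ n : ℕ, n ≠ 0 → 1 - n * t < Real.exp (-t) ^ n ∧ Real.exp (-t) ^ n < 1 := by
    intro n hn
    refine ⟨?_, pow_lt_one₀ h0 hlt hn⟩
    rw [← Real.exp_nat_mul]
    have hn' : (0 : ℝ) < n := by positivity
    have := Real.add_one_lt_exp (x := n * -t) (by simp [hn, ht.ne'])
    linarith
  have h5 := key 5 (by norm_num)
  have h7 := key 7 (by norm_num)
  have h10 := key 10 (by norm_num)
  push_cast at h5 h7 h10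
  refine ⟨?_, ?_, ?_, ?_⟩ <;> linarith

theorem eerk32_diffCoeff_ne_zero {z : ℝ} (hz : z < 0) :
    ∀ j ∈ Finset.Icc 1 3, diffCoeff (eerk32 (1 / 2) (7 / 10)) j j z ≠ 0 := by
  obtain ⟨t, rfl⟩ : ∃ t, z = -(10 * t) := ⟨-z / 10, by ring⟩
  have ht : 0 < t := by linarith
  obtain ⟨h21, -, h32, -, -, h43⟩ := eerk32_apply ht rfl rfl rfl rfl rfl rfl
  obtain ⟨hA, hQ, hR, -⟩ := eerk32_coeff_pos ht rfl rfl rfl rfl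
  intro j hj
  rw [diffCoeff, if_pos rfl]
  obtain ⟨h1, h2⟩ := Finset.mem_Icc.mp hj
  interval_cases j
  · rw [h21]
    positivity
  · rw [h32]
    positivity
  · rw [h43]
    positivity

theorem eerk32_diffForm_pos {z : ℝ} (hz : z < 0) (v : ℕ → ℝ) (hv : v 1 ≠ 0 ∨ v 2 ≠ 0 ∨ v 3 ≠ 0) :
    0 < diffForm (eerk32 (1 / 2) (7 / 10)) 3 z v := by
  have hne := eerk32_diffCoeff_ne_zero hz
  obtain ⟨t, rfl⟩ : ∃ t, z = -(10 * t) := ⟨-z / 10, by ring⟩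
  have ht : 0 < t := by linarith
  obtain ⟨x, hx⟩ : ∃ x, x = 10 * t := ⟨_, rfl⟩
  obtain ⟨A, hA⟩ : ∃ A, A = 1 - Real.exp (-t) ^ 5 := ⟨_, rfl⟩
  obtain ⟨Q, hQ⟩ : ∃ Q, Q = 42 / 25 * x - 64 / 25 + 14 / 25 * Real.exp (-t) ^ 5 +
    2 * Real.exp (-t) ^ 7 := ⟨_, rfl⟩
  obtain ⟨R, hR⟩ : ∃ R, R = 25 / 21 * (x - 1 + Real.exp (-t) ^ 10) := ⟨_, rfl⟩
  obtain ⟨X, hX⟩ : ∃ X, X = x * (1 - Real.exp (-t) ^ 7) - Q := ⟨_, rfl⟩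
  obtain ⟨W, hW⟩ : ∃ W, W = x * (1 - Real.exp (-t) ^ 10) - 32 / 25 * R := ⟨_, rfl⟩
  obtain ⟨h21, h31, h32, h41, h42, h43⟩ := eerk32_apply ht hx hA hQ hR hX hW
  obtain ⟨hA0, hQ0, hR0, hRx⟩ := eerk32_coeff_pos ht hx hA hQ hR
  have hx0 : 0 < x := by linarith
  have hminor := eerk32_minor_pos ht hx hQ hR
  have hdet := eerk32_det_pos ht hx hA hQ hR hX hW rfl rfl rfl rfl rfl rfl
  have hF : 0 < x * R - R ^ 2 / 2 := by
    have : x * R - R ^ 2 / 2 = R * (2 * x - R) / 2 := by ring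
    rw [this]
    have : 0 < 2 * x - R := by linarith
    positivity
  rw [← hx] at hne ⊢
  clear hA hQ hR hX hW
  generalize eerk32 (1 / 2) (7 / 10) = a at *
  obtain ⟨V₁, hV₁⟩ : ∃ V, A / x * V = v 1 := ⟨v 1 / (A / x), by field_simp⟩
  obtain ⟨V₂, hV₂⟩ : ∃ V, (X / x ^ 2 - A / x) * V₁ + Q / x ^ 2 * V = v 2 :=
    ⟨(v 2 - (X / x ^ 2 - A / x) * V₁) / (Q / x ^ 2), by field_simp; ring⟩
  obtain ⟨V₃, hV₃⟩ : ∃ V, (W / x ^ 2 - X / x ^ 2) * V₁ + (7 / 25 * R / x ^ 2 - Q / x ^ 2) * V₂ +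
      R / x ^ 2 * V = v 3 :=
    ⟨(v 3 - (W / x ^ 2 - X / x ^ 2) * V₁ - (7 / 25 * R / x ^ 2 - Q / x ^ 2) * V₂) / (R / x ^ 2),
      by field_simp; ring⟩
  have hV : V₁ ≠ 0 ∨ V₂ ≠ 0 ∨ V₃ ≠ 0 := by
    by_contra! h
    obtain ⟨h1, h2, h3⟩ := h
    simp only [h1, h2, h3, mul_zero, add_zero] at hV₁ hV₂ hV₃
    simp [← hV₁, ← hV₂, ← hV₃] at hv
  have hform := ternary_quadForm_pos hF hminor hdet hV
  rw [diffForm_three_eq (V := fun j => if j = 1 then V₁ else if j = 2 then V₂ else V₃) hne]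
  · refine lt_of_lt_of_eq (mul_pos (inv_pos.mpr (pow_pos hx0 3)) hform) ?_
    simp only [← hV₁, ← hV₂, ← hV₃, if_true, OfNat.ofNat_ne_one, if_false, Nat.reduceEqDiff]
    field_simp
    ring
  · intro l hl
    obtain ⟨h1, h2⟩ := Finset.mem_Icc.mp hl
    interval_cases l
    · simp [diffCoeff, h21, hV₁]
    · simp [diffCoeff, Finset.sum_Icc_succ_top, h21, h31, h32, ← hV₂]
    · simp [diffCoeff, Finset.sum_Icc_succ_top, h31, h32, h41, h42, h43, ← hV₃]

theorem eerk32_diffForm_nonneg {z : ℝ} (hz : z < 0) {j : ℕ} (hj : j ≤ 3) (v : ℕ → ℝ) :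
    0 ≤ diffForm (eerk32 (1 / 2) (7 / 10)) j z v := by
  rw [diffForm_eq_of_le _ hj]
  set w : ℕ → ℝ := fun k => if k ≤ j then v k else 0
  by_cases hw : w 1 ≠ 0 ∨ w 2 ≠ 0 ∨ w 3 ≠ 0
  · exact (eerk32_diffForm_pos hz w hw).le
  · push Not at hw
    simp [diffForm, Finset.sum_Icc_succ_top, hw.1, hw.2.1, hw.2.2]

variable {ι : Type*} [Fintype ι] [DecidableEq ι]

theorem act_add (M : Matrix ι ι ℝ) (v w : EuclideanSpace ℝ ι) :
    act M (v + w) = act M v + act M w := map_add _ v w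

theorem act_smul (M : Matrix ι ι ℝ) (c : ℝ) (v : EuclideanSpace ℝ ι) :
    act M (c • v) = c • act M v := map_smul _ c v

theorem inner_act_comm {M : Matrix ι ι ℝ} (hM : M.IsHermitian) (v w : EuclideanSpace ℝ ι) :
    inner ℝ v (act M w) = inner ℝ (act M v) w :=
  ((Matrix.isSymmetric_toEuclideanLin_iff.mpr hM) v w).symm

theorem act_cfc_eigenvectorBasis {A : Matrix ι ι ℝ} (hA : A.IsHermitian) (f : ℝ → ℝ) (i : ι) :
    act (cfc f A) (hA.eigenvectorBasis i) = f (hA.eigenvalues i) • hA.eigenvectorBasis i := by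
  have h : (cfc f A).mulVec (hA.eigenvectorBasis i) =
      f (hA.eigenvalues i) • ⇑(hA.eigenvectorBasis i) := by
    rw [hA.cfc_eq, Matrix.IsHermitian.cfc, Unitary.conjStarAlgAut_apply, ← Matrix.mulVec_mulVec,
      ← Matrix.mulVec_mulVec, hA.star_eigenvectorUnitary_mulVec,
      Matrix.diagonal_mulVec_single, Matrix.mulVec_single, hA.eigenvectorUnitary_col_eq]
    simp
  ext k
  exact congrFun h k

theorem inner_eigenvectorBasis_act_cfc {A : Matrix ι ι ℝ} (hA : A.IsHermitian) (f : ℝ → ℝ) (i : ι)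
    (v : EuclideanSpace ℝ ι) :
    inner ℝ (hA.eigenvectorBasis i) (act (cfc f A) v) =
      f (hA.eigenvalues i) * inner ℝ (hA.eigenvectorBasis i) v := by
  have h : (cfc f A).IsHermitian := cfc_predicate f A
  rw [inner_act_comm h, act_cfc_eigenvectorBasis, real_inner_smul_left]

theorem inner_eigenvectorBasis_act {A : Matrix ι ι ℝ} (hA : A.IsHermitian) (i : ι)
    (v : EuclideanSpace ℝ ι) :
    inner ℝ (hA.eigenvectorBasis i) (act A v) =
      hA.eigenvalues i * inner ℝ (hA.eigenvectorBasis i) v := by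
  have h := inner_eigenvectorBasis_act_cfc hA id i v
  rwa [cfc_id ℝ A hA.isSelfAdjoint] at h

theorem posDef_stabL {n : Type*} [DecidableEq n] {L : Matrix n n ℝ} (hL : L.PosDef) {κ : ℝ} (hκ : 0 ≤ κ) :
    (stabL L κ).PosDef :=
  hL.add_posSemidef (Matrix.PosSemidef.one.smul hκ)

theorem act_stabL (L : Matrix ι ι ℝ) (κ : ℝ) (v : EuclideanSpace ℝ ι) :
    act (stabL L κ) v = act L v + κ • v := by
  simp [act, stabL]

theorem isHermitian_neg_smul_stabL {n : Type*} [DecidableEq n] {L : Matrix n n ℝ}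
    (hL : L.PosDef) {κ : ℝ} (hκ : 0 ≤ κ) (τ : ℝ) : (-(τ • stabL L κ)).IsHermitian :=
  ((posDef_stabL hL hκ).isHermitian.smul (IsSelfAdjoint.all τ)).neg

theorem eigenvalues_neg_smul_stabL_neg {L : Matrix ι ι ℝ} (hL : L.PosDef) {κ τ : ℝ} (hκ : 0 ≤ κ)
    (hτ : 0 < τ) (h : (-(τ • stabL L κ)).IsHermitian) (i : ι) : h.eigenvalues i < 0 := by
  have hp := (posDef_stabL hL hκ).smul hτ
  have hne : (h.eigenvectorBasis i).ofLp ≠ 0 := by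
    intro h0
    have := h.eigenvectorBasis.orthonormal.ne_zero i
    exact this (by ext k; simp [h0])
  have := hp.dotProduct_mulVec_pos hne
  rw [h.eigenvalues_eq]
  simpa [Matrix.neg_mulVec] using this

/-- Descent estimate for a function with Lipschitz gradient `-g`. -/
theorem sub_le_of_hasGradientAt {E : Type*} [NormedAddCommGroup E] [InnerProductSpace ℝ E]
    [CompleteSpace E] {Φ : E → ℝ} {g : E → E} {ℓ : ℝ} (hΦ : ∀ v, HasGradientAt Φ (-g v) v)
    (hLip : ∀ u v, ‖g u - g v‖ ≤ ℓ * ‖u - v‖) (hℓ : 0 ≤ ℓ) (u δ : E) :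
    Φ (u + δ) - Φ u ≤ -inner ℝ δ (g u) + ℓ * ‖δ‖ ^ 2 := by
  have hd : ∀ s : ℝ, HasDerivAt (fun s : ℝ => Φ (u + s • δ)) (-inner ℝ δ (g (u + s • δ))) s := by
    intro s
    have h1 : HasDerivAt (fun s : ℝ => u + s • δ) δ s := by
      simpa using ((hasDerivAt_id s).smul_const δ).const_add u
    have h2 := (hΦ (u + s • δ)).hasFDerivAt.comp_hasDerivAt s h1
    refine h2.congr_deriv ?_
    rw [InnerProductSpace.toDual_apply_apply, inner_neg_left, real_inner_comm]
  obtain ⟨s, hs, h⟩ := exists_hasDerivAt_eq_slope (fun s : ℝ => Φ (u + s • δ)) _ zero_lt_one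
    (fun s _ => (hd s).continuousAt.continuousWithinAt) fun s _ => hd s
  simp only [one_smul, zero_smul, add_zero, sub_zero, div_one] at h
  rw [← h]
  have h3 : inner ℝ δ (g u - g (u + s • δ)) ≤ ℓ * ‖δ‖ ^ 2 := by
    refine (real_inner_le_norm _ _).trans ?_
    have h4 := hLip u (u + s • δ)
    rw [sub_add_cancel_left, norm_neg, norm_smul, Real.norm_of_nonneg hs.1.le] at h4
    calc ‖δ‖ * ‖g u - g (u + s • δ)‖ ≤ ‖δ‖ * (ℓ * (s * ‖δ‖)) := by gcongr
      _ ≤ ‖δ‖ * (ℓ * (1 * ‖δ‖)) := by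
        have := hs.2.le
        gcongr
      _ = ℓ * ‖δ‖ ^ 2 := by ring
  rw [inner_sub_right] at h3
  linarith

/-- One stage of the energy estimate. -/
theorem energy_add_sub_le {L : Matrix ι ι ℝ} (hL : L.PosDef)
    {g : EuclideanSpace ℝ ι → EuclideanSpace ℝ ι} {G : EuclideanSpace ℝ ι → ι → ℝ}
    (hgG : ∀ v, HasGradientAt (fun w => ∑ i, G w i) (-g v) v) {ℓ : ℝ} (hℓ : 0 ≤ ℓ)
    (hLip : ∀ u v, ‖g u - g v‖ ≤ ℓ * ‖u - v‖) {κ : ℝ} (hκ : 2 * ℓ ≤ κ)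
    (u δ : EuclideanSpace ℝ ι) :
    energy L G (u + δ) - energy L G u ≤
      -inner ℝ δ (stabG g κ u - act (stabL L κ) (u + (1 / 2 : ℝ) • δ)) := by
  have h := sub_le_of_hasGradientAt hgG hLip hℓ u δ
  have hs : inner ℝ u (act L δ) = inner ℝ δ (act L u) := by
    rw [inner_act_comm hL.isHermitian, real_inner_comm]
  have hk : ℓ * ‖δ‖ ^ 2 ≤ κ / 2 * ‖δ‖ ^ 2 := by
    gcongr
    linarith
  simp only [energy, stabG, act_stabL, act_add, act_smul, inner_add_left, inner_add_right,
    inner_sub_right, real_inner_smul_right, real_inner_self_eq_norm_sq, smul_add, hs]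
  linarith

variable {a : ℕ → ℕ → ℝ → ℝ} {s : ℕ} {L : Matrix ι ι ℝ}
  {g : EuclideanSpace ℝ ι → EuclideanSpace ℝ ι} {κ τ : ℝ} {U : ℕ → EuclideanSpace ℝ ι}

theorem IsStep.inner_eigenvectorBasis_sub (hU : IsStep a s L g κ τ U)
    (hA : (-(τ • stabL L κ)).IsHermitian) (i : ι) {k : ℕ} (hk : k ∈ Finset.Icc 1 s) :
    inner ℝ (hA.eigenvectorBasis i) (U (k + 1) - U k) =
      ∑ j ∈ Finset.Icc 1 k, diffCoeff a k j (hA.eigenvalues i) *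
        inner ℝ (hA.eigenvectorBasis i) (τ • stabG g κ (U j) - τ • act (stabL L κ) (U 1)) := by
  obtain ⟨h1, h2⟩ := Finset.mem_Icc.mp hk
  obtain ⟨k, rfl⟩ := Nat.exists_eq_add_of_le' h1
  have hstep : U (k + 1) = U 1 + ∑ j ∈ Finset.Icc 1 k,
      matFun L κ τ (a (k + 1) j) (τ • stabG g κ (U j) - τ • act (stabL L κ) (U 1)) := by
    rcases Nat.eq_zero_or_pos k with rfl | hk0
    · simp
    · exact hU k (Finset.mem_Icc.mpr ⟨hk0, by omega⟩)
  rw [hU (k + 1) hk, hstep, add_sub_add_left_eq_sub, Finset.sum_Icc_succ_top h1,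
    Finset.sum_Icc_succ_top h1, inner_sub_right, inner_add_right, inner_sum, inner_sum]
  simp only [matFun, inner_eigenvectorBasis_act_cfc hA]
  rw [add_sub_right_comm, ← Finset.sum_sub_distrib, diffCoeff, if_pos rfl]
  congr 1
  refine Finset.sum_congr rfl fun j hj => ?_
  rw [diffCoeff, if_neg (by have := (Finset.mem_Icc.mp hj).2; omega), sub_mul]

theorem IsStep.sum_matFun_diffEntry (hU : IsStep a s L g κ τ U)
    (hA : (-(τ • stabL L κ)).IsHermitian)
    (ha : ∀ i, ∀ j ∈ Finset.Icc 1 s, diffCoeff a j j (hA.eigenvalues i) ≠ 0)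
    {k : ℕ} (hk : k ∈ Finset.Icc 1 s) :
    ∑ l ∈ Finset.Icc 1 k, matFun L κ τ (diffEntry a k l) (U (l + 1) - U l) =
      τ • (stabG g κ (U k) -
        act (stabL L κ) (U k + (1 / 2 : ℝ) • (U (k + 1) - U k))) := by
  obtain ⟨h1, h2⟩ := Finset.mem_Icc.mp hk
  have hsub : Finset.Icc 1 k ⊆ Finset.Icc 1 s := Finset.Icc_subset_Icc_right h2
  refine InnerProductSpace.ext_inner_left_basis hA.eigenvectorBasis.toBasis fun i => ?_
  rw [OrthonormalBasis.coe_toBasis, inner_sum]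
  simp only [matFun, inner_eigenvectorBasis_act_cfc hA]
  rw [sum_diffEntry_mul h1 (fun j hj => ha i j (hsub hj))
    (fun l hl => hU.inner_eigenvectorBasis_sub hA i (hsub hl)), ← inner_sum]
  have hL : ∀ v, τ • act (stabL L κ) v = -act (-(τ • stabL L κ)) v := by
    intro v
    simp [act]
  have htel : ∑ l ∈ Finset.Icc 1 k, (U (l + 1) - U l) = U (k + 1) - U 1 := by
    rw [← Finset.Ico_succ_right_eq_Icc, Finset.sum_Ico_sub _ (by simp)]
    rfl
  rw [htel, smul_sub, hL, hL]
  simp only [inner_sub_right, inner_neg_right, inner_eigenvectorBasis_act hA, inner_add_right,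
    real_inner_smul_right]
  ring

theorem dissipation_eq_sum_diffForm (hA : (-(τ • stabL L κ)).IsHermitian) (j : ℕ) :
    dissipation a L κ τ U j = ∑ i, diffForm a j (hA.eigenvalues i)
      fun k => inner ℝ (hA.eigenvectorBasis i) (U (k + 1) - U k) := by
  simp only [dissipation, diffForm]
  rw [Finset.sum_comm]
  refine Finset.sum_congr rfl fun k _ => ?_
  rw [← hA.eigenvectorBasis.sum_inner_mul_inner]
  refine Finset.sum_congr rfl fun i _ => ?_
  rw [real_inner_comm, inner_sum]
  simp only [matFun, inner_eigenvectorBasis_act_cfc hA]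

theorem IsStep.energy_sub_le (hU : IsStep a s L g κ τ U) (hL : L.PosDef)
    {G : EuclideanSpace ℝ ι → ι → ℝ} (hgG : ∀ v, HasGradientAt (fun w => ∑ i, G w i) (-g v) v)
    {ℓ : ℝ} (hℓ : 0 ≤ ℓ) (hLip : ∀ u v, ‖g u - g v‖ ≤ ℓ * ‖u - v‖) (hκ : 2 * ℓ ≤ κ) (hτ : 0 < τ)
    (ha : ∀ z < 0, ∀ j ∈ Finset.Icc 1 s, diffCoeff a j j z ≠ 0) {j : ℕ} (hj : j ≤ s) :
    energy L G (U (j + 1)) - energy L G (U 1) ≤ -(1 / τ) * dissipation a L κ τ U j := by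
  have hκ0 : 0 ≤ κ := by linarith
  have hA := isHermitian_neg_smul_stabL hL hκ0 τ
  have htel : ∑ l ∈ Finset.Icc 1 j, (energy L G (U (l + 1)) - energy L G (U l)) =
      energy L G (U (j + 1)) - energy L G (U 1) := by
    rw [← Finset.Ico_succ_right_eq_Icc, Finset.sum_Ico_sub (fun l => energy L G (U l)) (by simp)]
    rfl
  rw [← htel, dissipation, Finset.mul_sum]
  refine Finset.sum_le_sum fun k hk => ?_
  rw [hU.sum_matFun_diffEntry hA
    (fun i => ha _ (eigenvalues_neg_smul_stabL_neg hL hκ0 hτ hA i))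
    (Finset.Icc_subset_Icc_right hj hk), real_inner_smul_right, ← mul_assoc, neg_mul,
    one_div_mul_cancel hτ.ne', neg_one_mul]
  have h := energy_add_sub_le hL hgG hℓ hLip hκ (U k) (U (k + 1) - U k)
  rwa [add_sub_cancel] at h

theorem dissipation_nonneg (hL : L.PosDef) (hκ : 0 ≤ κ) (hτ : 0 < τ) {j : ℕ}
    (ha : ∀ z < 0, ∀ v, 0 ≤ diffForm a j z v) : 0 ≤ dissipation a L κ τ U j := by
  have hA := isHermitian_neg_smul_stabL hL hκ τ
  rw [dissipation_eq_sum_diffForm hA]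
  exact Finset.sum_nonneg fun i _ => ha _ (eigenvalues_neg_smul_stabL_neg hL hκ hτ hA i) _

end EERK

end

theorem mainTheorem9 {ι : Type*} [Fintype ι] [DecidableEq ι] :
    (∀ z : ℝ, z < 0 →
      (EERK.symmPart (EERK.diffMatrix (EERK.eerk32 (1 / 2) (7 / 10)) 3 z)).PosDef) ∧
    ∀ (L : Matrix ι ι ℝ) (_hL : L.PosDef)
      (g : EuclideanSpace ℝ ι → EuclideanSpace ℝ ι)
      (G : EuclideanSpace ℝ ι → ι → ℝ) (_hG : ∀ v i, 0 ≤ G v i)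
      (_hgG : ∀ v, HasGradientAt (fun w => ∑ i, G w i) (-g v) v)
      (ℓ : ℝ) (_hℓ : 0 < ℓ) (_hLip : ∀ u v, ‖g u - g v‖ ≤ ℓ * ‖u - v‖)
      (κ : ℝ) (_hκ : 2 * ℓ ≤ κ)
      (τ : ℕ → ℝ) (_hτ : ∀ n, 1 ≤ n → 0 < τ n)
      (u : ℕ → EuclideanSpace ℝ ι) (U : ℕ → ℕ → EuclideanSpace ℝ ι)
      (_hU : EERK.IsSolution (EERK.eerk32 (1 / 2) (7 / 10)) 3 L g κ τ u U),
      ∀ n, 1 ≤ n → ∀ j ∈ Finset.Icc 1 3,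
        EERK.energy L G (U n (j + 1)) - EERK.energy L G (U n 1) ≤
          -(1 / τ n) * EERK.dissipation (EERK.eerk32 (1 / 2) (7 / 10)) L κ (τ n) (U n) j ∧
        0 ≤ EERK.dissipation (EERK.eerk32 (1 / 2) (7 / 10)) L κ (τ n) (U n) j ∧
        EERK.energy L G (U n (j + 1)) ≤ EERK.energy L G (U n 1) := by
  refine ⟨fun z hz => EERK.posDef_symmPart_diffMatrix (EERK.eerk32_diffForm_pos hz), ?_⟩
  intro L hL g G _ hgG ℓ hℓ hLip κ hκ τ hτ u U hU n hn j hj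
  have hj := (Finset.mem_Icc.mp hj).2
  have hτ := hτ n hn
  have h1 := (hU n hn).2.1.energy_sub_le hL hgG hℓ.le hLip hκ hτ
    (fun z hz => EERK.eerk32_diffCoeff_ne_zero hz) hj
  have h2 := EERK.dissipation_nonneg (U := U n) hL (by linarith : 0 ≤ κ) hτ
    (fun z hz v => EERK.eerk32_diffForm_nonneg hz hj v)
  refine ⟨h1, h2, ?_⟩
  have h3 : 0 ≤ 1 / τ n * EERK.dissipation (EERK.eerk32 (1 / 2) (7 / 10)) L κ (τ n) (U n) j := by
    positivity
  linarith
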